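/- **Meadows.** A meadow is a commutative ring with unit together with a total unary operation $(\_)^{-1}$ such that $(x^{-1})^{-1}=x$ and $x\cdot(x\cdot x^{-1})=x$ for all $x$. A cancellation meadow is a zero-totalized field, i.e. a meadow with $0\neq 1$ in which $x\neq 0$ and $x\cdot y=x\cdot z$ imply $y=z$. **Instruction sequences.** There are input variables $x_0,x_1,\dots$, auxiliary variables $a_0,a_1,\dots$ and one output variable $y$. The basic instructions are the assignments $$a_i.\mathtt{cp}(x_j)\,[a_i\Leftarrow x_j],\quad a_i.\mathtt{set{:}0}\,[a_i\Leftarrow 0],\quad a_i.\mathtt{set{:}1}\,[a_i\Leftarrow 1],\quad a_i.\mathtt{set{:}ai}\,[a_i\Leftarrow -a_i],\quad a_i.\mathtt{set{:}mi}\,[a_i\Leftarrow a_i^{-1}],$$ $$a_i.\mathtt{set{:}a}(a_j)\,[a_i\Leftarrow a_i+a_j],\quad a_i.\mathtt{set{:}m}(a_j)\,[a_i\Leftarrow a_i\cdot a_j],\quad y.\mathtt{cp}(a_j)\,[y\Leftarrow a_j]\qquad(i,j\in\mathbb N),$$ each of which always replies true, and the zero tests $a_i.\mathtt{test{:}0}$,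 which change nothing and reply true if and only if the value of $a_i$ is $0$. The primitive instructions are $b$, $+b$, $-b$ (for a basic instruction $b$), $\#k$ (for $k\in\mathbb N$) and $!$. Instruction sequences are built from primitive instructions by concatenation $I;J$ and repetition $I^\omega$ (that is, $I;I;I;\dots$), so each denotes a finite or eventually periodic infinite sequence of primitive instructions, where $I;J$ denotes the same as $I$ if $I$ is infinite. **Execution.** Execution starts at the first primitive instruction. At $b$ the basic instruction $b$ is performed and execution continues with the next instruction. At $+b$ the instruction $b$ is performed; on reply true execution continues with the next instruction, on reply false the next instruction is skipped. At $-b$ the roles of the replies are interchanged. At $\#k$ with $k\geq 1$ execution continues $k$ instructions ahead. At $!$ execution terminates. Deadlock occurs at $\#0$, in an infinite chain of jumps, and whenever the instruction to continue with does not exist. For an instruction sequence $I$, a number $k\in\mathbb N$ and a meadow $\mathcal M$, the partial mapping $[\![I]\!]^k_{\mathcal M}:\mathcal M^{k+1}\rightharpoonup\mathcal M$ is defined as follows: $I$ is executed on the initial assignment in which $x_i=m_i$ for $0\le i\le k$ and all other variables are $0$; if it terminates after finitely many steps, $[\![I]\!]^k_{\mathcal M}(m_0,\dots,m_k)$ is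 the final value of $y$, and otherwise it is undefined. An instruction sequence is *straight-line* if it is finite (built without repetition) and contains no tests and no jumps, i.e. consists only of assignment instructions and $!$. It *uses $n$ auxiliary variables* if the auxiliary variables occurring in it are precisely $a_0,\dots,a_{n-1}$. **Theorem.** Let $I$ be an instruction sequence and let $k\in\mathbb N$ be such that $[\![I]\!]^k_{\mathcal M}$ is a total mapping on $\mathcal M^{k+1}$ for every cancellation meadow $\mathcal M$. Then there exists a straight-line instruction sequence $J$ that uses at most $5$ auxiliary variables such that $[\![I]\!]^k_{\mathcal M}=[\![J]\!]^k_{\mathcal M}$ for all cancellation meadows $\mathcal M$. -/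

import Mathlib

universe u

namespace MeadowProgram

/-! ### Meadows -/

/-- A meadow: a commutative ring with unit and a total inverse operation satisfying
`(x⁻¹)⁻¹ = x` and the restricted inverse law `x * (x * x⁻¹) = x`. -/
class Meadow (M : Type u) extends CommRing M, Inv M where
  inv_inv_eq : ∀ x : M, (x⁻¹)⁻¹ = x
  mul_mul_inv_eq : ∀ x : M, x * (x * x⁻¹) = x

/-- A cancellation meadow, that is, a zero-totalized field: a nontrivial meadow in which every
nonzero element can be cancelled. -/
class CancellationMeadow (M : Type u) extends Meadow M, Nontrivial M where
  mul_cancel : ∀ x y z : M, x ≠ 0 → x * y = x * z → y = z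

/-! ### Program algebra -/

/-- The primitive instructions over a set `A` of basic instructions:
`a`, `+a`, `-a`, `#k` and `!`. -/
inductive Primitive (A : Type) : Type
  | basic (a : A)
  | posTest (a : A)
  | negTest (a : A)
  | jump (k : ℕ)
  | halt

/-- Instruction sequences `I ::= u | I ; I | I^ω`, where `u` is a primitive instruction. -/
inductive InstrSeq (A : Type) : Type
  | prim (u : Primitive A)
  | concat (I J : InstrSeq A)
  | rep (I : InstrSeq A)

/-- The first canonical form of an instruction sequence. The pair `(Y, Z)` stands for `Y ; Z^ω`
if `Z` is nonempty, and for the finite sequence `Y` otherwise. -/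
def InstrSeq.canon {A : Type} : InstrSeq A → List (Primitive A) × List (Primitive A)
  | .prim u => ([u], [])
  | .concat I J =>
    match I.canon with
    | (Y, []) => (Y ++ J.canon.1, J.canon.2)
    | (Y, z :: Z) => (Y, z :: Z)
  | .rep I =>
    match I.canon with
    | (Y, []) => ([], Y)
    | (Y, z :: Z) => (Y, z :: Z)

/-- The primitive instruction at position `p` (counted from `0`) of the finite or infinite sequence
of primitive instructions denoted by `I`; `none` beyond the end of a finite sequence. -/
def InstrSeq.instrAt {A : Type} (I : InstrSeq A) (p : ℕ) : Option (Primitive A) :=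
  if p < I.canon.1.length then I.canon.1[p]?
  else I.canon.2[(p - I.canon.1.length) % I.canon.2.length]?

/-! ### Threads -/

/-- The possible heads of a thread: termination `S`, deadlock `D`, or postconditional composition
`_ ⊴ a ⊵ _` for an action `a`. -/
inductive ThreadHead (A : Type) : Type
  | terminate
  | dead
  | post (a : A)

/-- The continuations of a thread: none for `S` and `D`, one for each reply for a postconditional
composition. -/
abbrev threadFunctor (A : Type) : PFunctor where
  A := ThreadHead A
  B := fun
    | .terminate => Empty
    | .dead => Empty
    | .post _ => Bool

/-- Finite and infinite threads: the trees, possibly of infinite depth, with the above heads.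
Such a tree is the same as a projective sequence of finite threads. -/
abbrev Thread (A : Type) : Type := (threadFunctor A).M

/-- Finite threads; `post T a T'` is the postconditional composition `T ⊴ a ⊵ T'`. -/
inductive FinThread (A : Type) : Type
  | terminate
  | dead
  | post (T : FinThread A) (a : A) (T' : FinThread A)

/-- The approximation operator `π_n`. -/
def Thread.approx {A : Type} : ℕ → Thread A → FinThread A
  | 0, _ => .dead
  | n + 1, T =>
    match T.dest with
    | ⟨.terminate, _⟩ => .terminate
    | ⟨.dead, _⟩ => .dead
    | ⟨.post a, f⟩ => .post (approx n (f true)) a (approx n (f false))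

/-! ### Thread extraction -/

/-- Follow the jump instruction at position `p` once; stay at `p` if there is no jump there. -/
def InstrSeq.hop {A : Type} (I : InstrSeq A) (p : ℕ) : ℕ :=
  match I.instrAt p with
  | some (.jump k) => p + k
  | _ => p

/-- Position `p` of `I` holds a jump instruction. -/
def InstrSeq.IsJumpAt {A : Type} (I : InstrSeq A) (p : ℕ) : Prop :=
  ∃ k, I.instrAt p = some (.jump k)

open Classical in
/-- The first position, on the chain of jumps starting at `p`, that holds no jump; there is none
if the chain runs into `#0` or is infinite. -/
noncomputable def InstrSeq.landing {A : Type} (I : InstrSeq A) (p : ℕ) : Option ℕ :=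
  if h : ∃ n, ¬ I.IsJumpAt (I.hop^[n] p) then some (I.hop^[Nat.find h] p) else none

/-- One step of the execution of `I` from position `p`: the head of the extracted thread, with the
position from which execution continues after each reply. Deadlock occurs if no instruction is
available. -/
noncomputable def InstrSeq.step {A : Type} (I : InstrSeq A) (p : ℕ) : threadFunctor A ℕ :=
  match I.landing p with
  | none => ⟨.dead, Empty.elim⟩
  | some q =>
    match I.instrAt q with
    | some (.basic a) => ⟨.post a, fun _ => q + 1⟩
    | some (.posTest a) => ⟨.post a, fun (b : Bool) => if b then q + 1 else q + 2⟩
    | some (.negTest a) => ⟨.post a, fun (b : Bool) => if b then q + 2 else q + 1⟩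
    | some .halt => ⟨.terminate, Empty.elim⟩
    | some (.jump _) => ⟨.dead, Empty.elim⟩
    | none => ⟨.dead, Empty.elim⟩

/-- Thread extraction `|I|`. -/
noncomputable def InstrSeq.thread {A : Type} (I : InstrSeq A) : Thread A :=
  PFunctor.M.corec I.step 0

/-! ### The meadow instruction set -/

/-- Input variables `x i`, auxiliary variables `a i`, and the output variable `y`. -/
inductive Var : Type
  | x (i : ℕ)
  | a (i : ℕ)
  | y
  deriving DecidableEq

/-- The instruction set for calculation in meadows. -/
inductive Ins : Type
  /-- `a_i.cp(x_j)` -/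
  | cpIn (i j : ℕ)
  /-- `a_i.set:0` -/
  | setZero (i : ℕ)
  /-- `a_i.set:1` -/
  | setOne (i : ℕ)
  /-- `a_i.set:ai` -/
  | setNeg (i : ℕ)
  /-- `a_i.set:mi` -/
  | setInv (i : ℕ)
  /-- `a_i.set:a(a_j)` -/
  | setAdd (i j : ℕ)
  /-- `a_i.set:m(a_j)` -/
  | setMul (i j : ℕ)
  /-- `a_i.test:0` -/
  | testZero (i : ℕ)
  /-- `y.cp(a_j)` -/
  | cpOut (j : ℕ)

/-- The new assignment after execution of an instruction. -/
def Ins.effect {M : Type u} [Meadow M] : Ins → (Var → M) → (Var → M)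
  | .cpIn i j, α => Function.update α (.a i) (α (.x j))
  | .setZero i, α => Function.update α (.a i) 0
  | .setOne i, α => Function.update α (.a i) 1
  | .setNeg i, α => Function.update α (.a i) (-α (.a i))
  | .setInv i, α => Function.update α (.a i) (α (.a i))⁻¹
  | .setAdd i j, α => Function.update α (.a i) (α (.a i) + α (.a j))
  | .setMul i j, α => Function.update α (.a i) (α (.a i) * α (.a j))
  | .testZero _, α => α
  | .cpOut j, α => Function.update α .y (α (.a j))

open Classical in
/-- The Boolean reply: assignment instructions always reply `true`, and the zero test replies
whether the value of the tested variable is `0`. -/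
noncomputable def Ins.reply {M : Type u} [Meadow M] : Ins → (Var → M) → Bool
  | .testZero i, α => decide (α (.a i) = 0)
  | _, _ => true

/-! ### Termination, application and the computed mapping -/

/-- `terminatesIn n T` is the set of assignments on which `T` terminates after at most
`n` steps. -/
noncomputable def terminatesIn {M : Type u} [Meadow M] : ℕ → Thread Ins → Set (Var → M)
  | 0, T =>
    match T.dest with
    | ⟨.terminate, _⟩ => Set.univ
    | ⟨.dead, _⟩ => ∅
    | ⟨.post _, _⟩ => ∅
  | n + 1, T =>
    match T.dest with
    | ⟨.terminate, _⟩ => Set.univ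
    | ⟨.dead, _⟩ => ∅
    | ⟨.post i, f⟩ => {α | i.effect α ∈ terminatesIn n (f (i.reply α))}

/-- The apply operator `T • α` of finite threads on assignments, where `none` is the
deadlock value `D`. -/
noncomputable def FinThread.apply {M : Type u} [Meadow M] :
    FinThread Ins → Option (Var → M) → Option (Var → M)
  | _, none => none
  | .terminate, some α => some α
  | .dead, some _ => none
  | .post T i T', some α =>
    if i.reply α then T.apply (some (i.effect α)) else T'.apply (some (i.effect α))

/-- The initial assignment with `x_i = m_i` for `i ≤ k` and value `0` elsewhere. -/
def initial {M : Type u} [Meadow M] {k : ℕ} (m : Fin (k + 1) → M) : Var → M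
  | .x i => if h : i < k + 1 then m ⟨i, h⟩ else 0
  | .a _ => 0
  | .y => 0

open Classical in
/-- The partial mapping `M^(k+1) → M` computed by a thread. It is defined at `m` if the thread
terminates on the initial assignment of `m` after at most `n` steps for some `n`, and then its value
is that of `y` after application of the approximation `π_(n+1)`. -/
noncomputable def Thread.mapping (M : Type u) [Meadow M] (k : ℕ) (T : Thread Ins) :
    (Fin (k + 1) → M) →. M := fun m =>
  Part.bind ⟨∃ n, initial m ∈ terminatesIn n T, fun h => Nat.find h⟩ fun n =>
    Part.ofOption (((T.approx (n + 1)).apply (some (initial m))).map fun α => α .y)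

/-- The partial mapping `M^(k+1) → M` computed by an instruction sequence. -/
noncomputable def InstrSeq.mapping (M : Type u) [Meadow M] (k : ℕ) (I : InstrSeq Ins) :
    (Fin (k + 1) → M) →. M :=
  Thread.mapping M k I.thread

/-! ### Straight-line instruction sequences and auxiliary variables -/

/-- Straight-line instruction sequences: finite (without repetition), without tests and without
jumps. The zero test is excluded also as a plain basic instruction, so that only assignment
instructions and `!` remain. -/
def InstrSeq.IsStraightLine : InstrSeq Ins → Prop
  | .prim (.basic (.testZero _)) => False
  | .prim (.basic _) => True
  | .prim .halt => True
  | .prim (.posTest _) => False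
  | .prim (.negTest _) => False
  | .prim (.jump _) => False
  | .concat I J => I.IsStraightLine ∧ J.IsStraightLine
  | .rep _ => False

/-- The indices of the auxiliary variables occurring in a basic instruction. -/
def Ins.auxVars : Ins → Finset ℕ
  | .cpIn i _ => {i}
  | .setZero i => {i}
  | .setOne i => {i}
  | .setNeg i => {i}
  | .setInv i => {i}
  | .setAdd i j => {i, j}
  | .setMul i j => {i, j}
  | .testZero i => {i}
  | .cpOut j => {j}

/-- The indices of the auxiliary variables occurring in an instruction sequence. -/
def InstrSeq.auxVars : InstrSeq Ins → Finset ℕ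
  | .prim (.basic i) => i.auxVars
  | .prim (.posTest i) => i.auxVars
  | .prim (.negTest i) => i.auxVars
  | .prim (.jump _) => ∅
  | .prim .halt => ∅
  | .concat I J => I.auxVars ∪ J.auxVars
  | .rep I => I.auxVars

/-- `I` uses `n` auxiliary variables: it uses precisely `a_0, …, a_(n-1)`. -/
def InstrSeq.UsesAux (I : InstrSeq Ins) (n : ℕ) : Prop :=
  I.auxVars = Finset.range n

end MeadowProgram

/-! The heart of the matter is compactness. If no number of steps sufficed for all meadows and
inputs, there would be for each `n` a meadow and an input on which `I` does not stop within depth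
`n`. Their ultraproduct is again a cancellation meadow, in the same universe, so `I` stops there at
some depth `N`. A run of depth `N` involves finitely many operations and tests, so it is mirrored in
almost all factors, a contradiction (`Thread.exists_exec_bound`).

A run of bounded depth is a finite decision tree, and `c * c⁻¹`, which is `0` or `1`, turns each
test into arithmetic. The output is thus one meadow term (`Thread.exists_meadowTerm_exec`).

A nested term may need many registers, so it is first flattened into a sum of fractions of integer
polynomials (`MeadowTerm.exists_fractionSum_eq`). Such a sum is evaluated monomial by monomial with
four auxiliary variables (`fractionSumCode_output`). -/

namespace MeadowProgram

/-! ### Cancellation meadows and fields -/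

/-- A cancellation meadow is a field with `0⁻¹ = 0`. -/
abbrev CancellationMeadow.toField (M : Type u) [CancellationMeadow M] : Field M :=
  { (inferInstance : CommRing M), (inferInstance : Nontrivial M) with
    inv := Inv.inv
    mul_inv_cancel := fun x hx =>
      CancellationMeadow.mul_cancel x _ _ hx (by rw [Meadow.mul_mul_inv_eq, mul_one])
    inv_zero := by
      -- At `0⁻¹` the restricted inverse law has the factor `(0⁻¹)⁻¹ = 0`.
      have h := Meadow.mul_mul_inv_eq (0⁻¹ : M)
      rw [Meadow.inv_inv_eq, mul_zero, mul_zero] at h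
      exact h.symm
    nnqsmul := _
    nnqsmul_def := fun _ _ => rfl
    qsmul := _
    qsmul_def := fun _ _ => rfl }

/-- A field, with `0⁻¹ = 0`, is a cancellation meadow. -/
abbrev CancellationMeadow.ofField (K : Type u) [Field K] : CancellationMeadow K :=
  { (inferInstance : CommRing K), (inferInstance : Nontrivial K) with
    inv := Inv.inv
    inv_inv_eq := inv_inv
    mul_mul_inv_eq := fun x => by
      rcases eq_or_ne x 0 with rfl | hx
      · rw [zero_mul]
      · rw [mul_inv_cancel₀ hx, mul_one]
    mul_cancel := fun _ _ _ hx h => mul_left_cancel₀ hx h }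

/-! ### Bounded execution of threads -/

/-- The final assignment of `T` on `α`, if `T` terminates before depth `n`. -/
noncomputable def Thread.exec {M : Type u} [Meadow M] (n : ℕ) (T : Thread Ins) (α : Var → M) :
    Option (Var → M) :=
  (T.approx n).apply (some α)

section Exec

variable {M : Type u} [Meadow M] {T : Thread Ins} {α β : Var → M}

theorem Thread.exec_zero : T.exec 0 α = none := by
  simp [Thread.exec, Thread.approx, FinThread.apply]

theorem Thread.exec_succ_terminate {f} (h : T.dest = ⟨.terminate, f⟩) (n : ℕ) :
    T.exec (n + 1) α = some α := by
  simp [Thread.exec, Thread.approx, FinThread.apply, h]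

theorem Thread.exec_succ_dead {f} (h : T.dest = ⟨.dead, f⟩) (n : ℕ) :
    T.exec (n + 1) α = none := by
  simp [Thread.exec, Thread.approx, FinThread.apply, h]

theorem Thread.exec_succ_post {i f} (h : T.dest = ⟨.post i, f⟩) (n : ℕ) :
    T.exec (n + 1) α = Thread.exec n (f (i.reply α)) (i.effect α) := by
  simp only [Thread.exec, Thread.approx, FinThread.apply, h]
  cases i.reply α <;> simp

theorem Thread.exec_succ_of_exec {n : ℕ} (h : T.exec n α = some β) :
    T.exec (n + 1) α = some β := by
  induction n generalizing T α with
  | zero => simp [Thread.exec_zero] at h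
  | succ n ih =>
    rcases hT : T.dest with ⟨_ | _ | i, f⟩
    · rwa [Thread.exec_succ_terminate hT] at h ⊢
    · rw [Thread.exec_succ_dead hT] at h; cases h
    · rw [Thread.exec_succ_post hT] at h ⊢
      exact ih h

theorem Thread.exec_of_le {n n' : ℕ} (hn : n ≤ n') (h : T.exec n α = some β) :
    T.exec n' α = some β :=
  Nat.le_induction h (fun _ _ => Thread.exec_succ_of_exec) n' hn

/-- The shift by one arises because `terminatesIn 0` still inspects the head of the thread, while
`approx 0` is already deadlock. -/
theorem mem_terminatesIn_iff {n : ℕ} :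
    α ∈ terminatesIn n T ↔ ∃ β, T.exec (n + 1) α = some β := by
  induction n generalizing T α with
  | zero =>
    rcases hT : T.dest with ⟨_ | _ | i, f⟩
    · simp [Thread.exec_succ_terminate hT, terminatesIn, hT]
    · simp [Thread.exec_succ_dead hT, terminatesIn, hT]
    · simp [Thread.exec_succ_post hT, Thread.exec_zero, terminatesIn, hT]
  | succ n ih =>
    rcases hT : T.dest with ⟨_ | _ | i, f⟩
    · simp [Thread.exec_succ_terminate hT, terminatesIn, hT]
    · simp [Thread.exec_succ_dead hT, terminatesIn, hT]
    · rw [Thread.exec_succ_post hT, ← ih]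
      simp [terminatesIn, hT]

/-- Results persist at larger depths, so the least depth chosen in the definition is immaterial and
any sufficient depth gives the same value. -/
theorem Thread.mem_mapping_iff {k : ℕ} {m : Fin (k + 1) → M} {v : M} :
    v ∈ Thread.mapping M k T m ↔ ∃ n β, T.exec n (initial m) = some β ∧ β .y = v := by
  classical
  simp only [Thread.mapping, Part.mem_bind_iff, Part.mem_ofOption, Option.mem_def,
    Option.map_eq_some_iff]
  constructor
  · rintro ⟨n, -, β, h⟩
    exact ⟨n + 1, β, h⟩
  · rintro ⟨n, β, h, hv⟩
    have hT : ∃ n, initial m ∈ terminatesIn n T :=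
      ⟨n, mem_terminatesIn_iff.2 ⟨β, Thread.exec_succ_of_exec h⟩⟩
    refine ⟨Nat.find hT, ⟨hT, ?_⟩, β, ?_, hv⟩
    · congr
    · obtain ⟨β', h'⟩ := mem_terminatesIn_iff.1 (Nat.find_spec hT)
      have h₁ := Thread.exec_of_le (Nat.le_add_right n (Nat.find hT + 1)) h
      have h₂ := Thread.exec_of_le (Nat.le_add_left (Nat.find hT + 1) n) h'
      rw [h₁, Option.some_inj] at h₂
      rw [h₂]
      exact h'

theorem Thread.exists_exec_of_mapping_dom {k : ℕ} {m : Fin (k + 1) → M}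
    (h : (Thread.mapping M k T m).Dom) : ∃ n β, T.exec n (initial m) = some β := by
  obtain ⟨v, hv⟩ := Part.dom_iff_mem.1 h
  obtain ⟨n, β, hβ, -⟩ := Thread.mem_mapping_iff.1 hv
  exact ⟨n, β, hβ⟩

end Exec

/-! ### Ultraproducts and the bound on the number of steps -/

section Ultraproduct

variable (M : ℕ → Type u) [∀ n, CancellationMeadow (M n)]

/-- The families that vanish almost everywhere with respect to a nonprincipal ultrafilter. -/
def nullIdeal : Ideal (∀ n, M n) where
  carrier := {f | ∀ᶠ n in (Filter.hyperfilter ℕ : Filter ℕ), f n = 0}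
  zero_mem' := Filter.Eventually.of_forall fun _ => rfl
  add_mem' := fun ha hb => by
    filter_upwards [ha, hb] with n h₁ h₂
    rw [Pi.add_apply, h₁, h₂, add_zero]
  smul_mem' := fun c f hf => by
    filter_upwards [hf] with n h
    rw [smul_eq_mul, Pi.mul_apply, h, mul_zero]

theorem mem_nullIdeal {f : ∀ n, M n} :
    f ∈ nullIdeal M ↔ ∀ᶠ n in (Filter.hyperfilter ℕ : Filter ℕ), f n = 0 := Iff.rfl

/-- By the ultrafilter property, a family outside the ideal is nonzero almost everywhere; its
componentwise inverse is then an inverse modulo the ideal. -/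
instance nullIdeal_isMaximal : (nullIdeal M).IsMaximal := by
  refine Ideal.isMaximal_iff.2 ⟨fun h => ?_, fun J f hJ hf hfJ => ?_⟩
  · obtain ⟨n, hn⟩ := ((mem_nullIdeal M).1 h).exists
    exact one_ne_zero hn
  · have hf' : ∀ᶠ n in (Filter.hyperfilter ℕ : Filter ℕ), f n ≠ 0 :=
      Ultrafilter.eventually_not.2 hf
    have h₁ : (1 - (fun n => (f n)⁻¹) * f) ∈ nullIdeal M := by
      rw [mem_nullIdeal]
      filter_upwards [hf'] with n hn
      let := CancellationMeadow.toField (M n)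
      exact sub_eq_zero.2 (inv_mul_cancel₀ hn).symm
    have h₂ := J.add_mem (hJ h₁) (J.mul_mem_left (fun n => (f n)⁻¹) hfJ)
    rwa [sub_add_cancel] at h₂

/-- The ultraproduct of a sequence of cancellation meadows. -/
def Ultraproduct : Type u := (∀ n, M n) ⧸ nullIdeal M

noncomputable instance : Field (Ultraproduct M) := Ideal.Quotient.field (nullIdeal M)

noncomputable instance : CancellationMeadow (Ultraproduct M) := CancellationMeadow.ofField _

/-- The class of a family in the ultraproduct. -/
noncomputable def Ultraproduct.mk : (∀ n, M n) →+* Ultraproduct M :=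
  Ideal.Quotient.mk (nullIdeal M)

theorem Ultraproduct.mk_eq_zero_iff {f : ∀ n, M n} :
    Ultraproduct.mk M f = 0 ↔ ∀ᶠ n in (Filter.hyperfilter ℕ : Filter ℕ), f n = 0 :=
  Ideal.Quotient.eq_zero_iff_mem

/-- For the zero class, uniqueness of inverses says nothing; there the convention `0⁻¹ = 0` in
almost all factors is what matches the one in the quotient. -/
theorem Ultraproduct.mk_inv (f : ∀ n, M n) :
    Ultraproduct.mk M (fun n => (f n)⁻¹) = (Ultraproduct.mk M f)⁻¹ := by
  by_cases hf : Ultraproduct.mk M f = 0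
  · rw [hf, inv_zero, Ultraproduct.mk_eq_zero_iff]
    filter_upwards [(Ultraproduct.mk_eq_zero_iff M).1 hf] with n hn
    let := CancellationMeadow.toField (M n)
    rw [hn]
    exact inv_zero
  · refine eq_inv_of_mul_eq_one_left ?_
    rw [← map_mul, ← map_one (Ultraproduct.mk M), ← sub_eq_zero, ← map_sub,
      Ultraproduct.mk_eq_zero_iff]
    have hf' := Ultrafilter.eventually_not.2 (mt (Ultraproduct.mk_eq_zero_iff M).2 hf)
    filter_upwards [hf'] with n hn
    let := CancellationMeadow.toField (M n)
    exact sub_eq_zero.2 (inv_mul_cancel₀ hn)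

/-- The assignment in the ultraproduct given by a sequence of assignments. -/
noncomputable def Ultraproduct.assignment (α : ∀ n, Var → M n) : Var → Ultraproduct M :=
  fun v => Ultraproduct.mk M fun n => α n v

theorem Ultraproduct.assignment_update (α : ∀ n, Var → M n) (v : Var) (f : ∀ n, M n) :
    Ultraproduct.assignment M (fun n => Function.update (α n) v (f n)) =
      Function.update (Ultraproduct.assignment M α) v (Ultraproduct.mk M f) := by
  funext w
  rcases eq_or_ne w v with rfl | h
  · simp [Ultraproduct.assignment]
  · simp [Ultraproduct.assignment, h]

theorem Ultraproduct.assignment_effect (i : Ins) (α : ∀ n, Var → M n) :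
    Ultraproduct.assignment M (fun n => i.effect (α n)) =
      i.effect (Ultraproduct.assignment M α) := by
  cases i <;> simp only [Ins.effect, Ultraproduct.assignment_update]
  case cpIn | cpOut => rfl
  case setZero => exact congrArg _ (map_zero (Ultraproduct.mk M))
  case setOne => exact congrArg _ (map_one (Ultraproduct.mk M))
  case setNeg => exact congrArg _ (map_neg (Ultraproduct.mk M) _)
  case setInv => exact congrArg _ (Ultraproduct.mk_inv M _)
  case setAdd => exact congrArg _ (map_add (Ultraproduct.mk M) _ _)
  case setMul => exact congrArg _ (map_mul (Ultraproduct.mk M) _ _)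

/-- This is Łoś's theorem for the zero test. The reply `false` transfers because an ultrafilter
contains each set or its complement. -/
theorem Ultraproduct.eventually_reply_eq (i : Ins) (α : ∀ n, Var → M n) :
    ∀ᶠ n in (Filter.hyperfilter ℕ : Filter ℕ),
      i.reply (α n) = i.reply (Ultraproduct.assignment M α) := by
  cases i
  case testZero i =>
    simp only [Ins.reply, decide_eq_decide]
    by_cases h : Ultraproduct.assignment M α (.a i) = 0
    · filter_upwards [(Ultraproduct.mk_eq_zero_iff M).1 h] with n hn
      exact iff_of_true hn h
    · filter_upwards [Ultrafilter.eventually_not.2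
        (mt (Ultraproduct.mk_eq_zero_iff M).2 h)] with n hn
      exact iff_of_false hn h
  all_goals exact Filter.Eventually.of_forall fun _ => rfl

/-- Only `N` replies can matter, and finitely many conditions that hold almost everywhere hold
jointly almost everywhere. -/
theorem Ultraproduct.eventually_exec {N : ℕ} {T : Thread Ins} {α : ∀ n, Var → M n}
    (h : ∃ β, T.exec N (Ultraproduct.assignment M α) = some β) :
    ∀ᶠ n in (Filter.hyperfilter ℕ : Filter ℕ), ∃ β, T.exec N (α n) = some β := by
  induction N generalizing T α with
  | zero => simp [Thread.exec_zero] at h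
  | succ N ih =>
    rcases hT : T.dest with ⟨_ | _ | i, f⟩
    · exact Filter.Eventually.of_forall fun n => ⟨_, Thread.exec_succ_terminate hT N⟩
    · simp [Thread.exec_succ_dead hT] at h
    · simp only [Thread.exec_succ_post hT] at h ⊢
      rw [← Ultraproduct.assignment_effect] at h
      filter_upwards [ih h, Ultraproduct.eventually_reply_eq M i α] with n h₁ h₂
      rwa [h₂]

end Ultraproduct

/-- A thread that terminates on all inputs over all cancellation meadows does so within a number
of steps that depends neither on the meadow nor on the input. -/
theorem Thread.exists_exec_bound (T : Thread Ins) (k : ℕ)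
    (h : ∀ (M : Type u) [CancellationMeadow M] (m : Fin (k + 1) → M),
      ∃ n β, T.exec n (initial m) = some β) :
    ∃ N, ∀ (M : Type u) [CancellationMeadow M] (m : Fin (k + 1) → M),
      ∃ β, T.exec N (initial m) = some β := by
  by_contra! hN
  -- The counterexample to the bound `n` serves as the `n`-th factor.
  choose M inst m hm using hN
  obtain ⟨N, hβ⟩ := h (Ultraproduct M) fun i => Ultraproduct.mk M fun n => m n i
  have hinit : (initial fun i => Ultraproduct.mk M fun n => m n i) =
      Ultraproduct.assignment M fun n => initial (m n) := by
    funext v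
    cases v with
    | x i =>
      by_cases hi : i < k + 1
      · simp [initial, Ultraproduct.assignment, hi]
      · simp only [initial, Ultraproduct.assignment, hi, dite_false]
        exact (map_zero (Ultraproduct.mk M)).symm
    | a i => exact (map_zero (Ultraproduct.mk M)).symm
    | y => exact (map_zero (Ultraproduct.mk M)).symm
  rw [hinit] at hβ
  -- Here the ultrafilter has to be nonprincipal: a factor with `n ≥ N` is needed, so that
  -- termination at depth `N` contradicts the choice of `m n`.
  have hge : ∀ᶠ n in (Filter.hyperfilter ℕ : Filter ℕ), N ≤ n := by
    have := Filter.eventually_ge_atTop (α := ℕ) N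
    rw [← Nat.cofinite_eq_atTop] at this
    exact this.filter_mono (Filter.hyperfilter_le_cofinite)
  obtain ⟨n, ⟨β, h₁⟩, h₂⟩ := ((Ultraproduct.eventually_exec M hβ).and hge).exists
  exact hm n β (Thread.exec_of_le h₂ h₁)

/-! ### Meadow terms and symbolic execution -/

/-- Meadow terms over the input variables. -/
inductive MeadowTerm : Type
  | var (i : ℕ)
  | zero
  | one
  | neg (s : MeadowTerm)
  | inv (s : MeadowTerm)
  | add (s t : MeadowTerm)
  | mul (s t : MeadowTerm)

/-- The value of a meadow term. -/
def MeadowTerm.eval {M : Type u} [Meadow M] (ρ : ℕ → M) : MeadowTerm → M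
  | .var i => ρ i
  | .zero => 0
  | .one => 1
  | .neg s => -s.eval ρ
  | .inv s => (s.eval ρ)⁻¹
  | .add s t => s.eval ρ + t.eval ρ
  | .mul s t => s.eval ρ * t.eval ρ

/-- The term `(1 - c * c⁻¹) * s + c * c⁻¹ * t`. -/
def MeadowTerm.ite (c s t : MeadowTerm) : MeadowTerm :=
  .add (.mul (.add .one (.neg (.mul c (.inv c)))) s) (.mul (.mul c (.inv c)) t)

open Classical in
theorem MeadowTerm.eval_ite {M : Type u} [CancellationMeadow M] (ρ : ℕ → M)
    (c s t : MeadowTerm) :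
    (MeadowTerm.ite c s t).eval ρ = if c.eval ρ = 0 then s.eval ρ else t.eval ρ := by
  let := CancellationMeadow.toField M
  simp only [MeadowTerm.ite, MeadowTerm.eval]
  split_ifs with h
  · rw [h]; ring
  · have h' : c.eval ρ * (c.eval ρ)⁻¹ = 1 := mul_inv_cancel₀ h
    rw [h']; ring

/-- The effect of an instruction on an assignment of meadow terms. -/
def Ins.symbolicEffect : Ins → (Var → MeadowTerm) → (Var → MeadowTerm)
  | .cpIn i j, σ => Function.update σ (.a i) (σ (.x j))
  | .setZero i, σ => Function.update σ (.a i) .zero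
  | .setOne i, σ => Function.update σ (.a i) .one
  | .setNeg i, σ => Function.update σ (.a i) (.neg (σ (.a i)))
  | .setInv i, σ => Function.update σ (.a i) (.inv (σ (.a i)))
  | .setAdd i j, σ => Function.update σ (.a i) (.add (σ (.a i)) (σ (.a j)))
  | .setMul i j, σ => Function.update σ (.a i) (.mul (σ (.a i)) (σ (.a j)))
  | .testZero _, σ => σ
  | .cpOut j, σ => Function.update σ .y (σ (.a j))

theorem Ins.eval_symbolicEffect {M : Type u} [Meadow M] (ρ : ℕ → M) (i : Ins)
    (σ : Var → MeadowTerm) :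
    (fun v => (i.symbolicEffect σ v).eval ρ) = i.effect fun v => (σ v).eval ρ := by
  funext v
  cases i <;> simp only [Ins.symbolicEffect, Ins.effect, Function.update_apply] <;>
    (try split_ifs) <;> rfl

/-- The output of a bounded execution is given by a meadow term. -/
theorem Thread.exists_meadowTerm_exec (N : ℕ) (T : Thread Ins) (σ : Var → MeadowTerm) :
    ∃ t : MeadowTerm, ∀ (M : Type u) [CancellationMeadow M] (ρ : ℕ → M) (β : Var → M),
      T.exec N (fun v => (σ v).eval ρ) = some β → β .y = t.eval ρ := by
  induction N generalizing T σ with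
  | zero => exact ⟨.zero, fun M _ ρ β h => by simp [Thread.exec_zero] at h⟩
  | succ N ih =>
    rcases hT : T.dest with ⟨_ | _ | i, f⟩
    · refine ⟨σ .y, fun M _ ρ β h => ?_⟩
      rw [Thread.exec_succ_terminate hT, Option.some_inj] at h
      rw [← h]
    · exact ⟨.zero, fun M _ ρ β h => by simp [Thread.exec_succ_dead hT] at h⟩
    · obtain ⟨s, hs⟩ := ih (f true) (i.symbolicEffect σ)
      obtain ⟨t, ht⟩ := ih (f false) (i.symbolicEffect σ)
      simp only [Ins.eval_symbolicEffect] at hs ht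
      cases i
      case testZero i =>
        -- The test is the only instruction whose two branches both matter; they merge into one
        -- term.
        refine ⟨.ite (σ (.a i)) s t, fun M _ ρ β h => ?_⟩
        rw [Thread.exec_succ_post hT] at h
        rw [MeadowTerm.eval_ite]
        split_ifs with hc
        · rw [show (Ins.testZero i).reply (fun v => (σ v).eval ρ) = true by
            simpa [Ins.reply] using hc] at h
          exact hs M ρ β h
        · rw [show (Ins.testZero i).reply (fun v => (σ v).eval ρ) = false by
            simpa [Ins.reply] using hc] at h
          exact ht M ρ β h
      -- Assignments always reply `true`, so the term of the other branch is dropped.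
      all_goals
        refine ⟨s, fun M _ ρ β h => hs M ρ β ?_⟩
        rwa [Thread.exec_succ_post hT] at h

/-! ### Meadow terms as sums of fractions of polynomials -/

/-- Case distinctions between fractions: `leaf p q` is `p / q`, and `node c s t` is `s` if `c = 0`
and `t` otherwise. -/
inductive FractionTree : Type
  | leaf (p q : MvPolynomial ℕ ℤ)
  | node (c : MvPolynomial ℕ ℤ) (s t : FractionTree)

namespace FractionTree

open Classical in
/-- The value of a case distinction between fractions. -/
noncomputable def eval {M : Type u} [Meadow M] (ρ : ℕ → M) : FractionTree → M
  | leaf p q => MvPolynomial.aeval ρ p * (MvPolynomial.aeval ρ q)⁻¹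
  | node c s t => if MvPolynomial.aeval ρ c = 0 then s.eval ρ else t.eval ρ

/-- Substitution for the fractions. -/
def bind (f : MvPolynomial ℕ ℤ → MvPolynomial ℕ ℤ → FractionTree) : FractionTree → FractionTree
  | leaf p q => f p q
  | node c s t => node c (s.bind f) (t.bind f)

/-- Any function commutes with case distinction, so meadow operations need only be realized on
leaves. -/
theorem eval_bind {M : Type u} [Meadow M] {ρ : ℕ → M} {g : M → M}
    {f : MvPolynomial ℕ ℤ → MvPolynomial ℕ ℤ → FractionTree}
    (h : ∀ p q, (f p q).eval ρ = g ((leaf p q).eval ρ)) (t : FractionTree) :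
    (t.bind f).eval ρ = g (t.eval ρ) := by
  induction t with
  | leaf p q => exact h p q
  | node c s t ihs iht =>
    simp only [bind, eval, ihs, iht]
    split_ifs <;> rfl

/-- The sum of two fractions. -/
noncomputable def addLeaf (p q p' q' : MvPolynomial ℕ ℤ) : FractionTree :=
  node q (leaf p' q') (node q' (leaf p q) (leaf (p * q' + p' * q) (q * q')))

/-- A common denominator is legitimate only if both denominators are nonzero; a fraction with
denominator `0` is `0` and drops out. Addition is the one operation that forces case distinctions.
-/
theorem eval_addLeaf {M : Type u} [CancellationMeadow M] (ρ : ℕ → M)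
    (p q p' q' : MvPolynomial ℕ ℤ) :
    (addLeaf p q p' q').eval ρ = (leaf p q).eval ρ + (leaf p' q').eval ρ := by
  let := CancellationMeadow.toField M
  simp only [addLeaf, eval, map_add, map_mul]
  have h0 : ((0 : M)⁻¹) = 0 := inv_zero
  split_ifs with h h'
  · rw [h, h0, mul_zero, zero_add]
  · rw [h', h0, mul_zero, add_zero]
  · generalize MvPolynomial.aeval ρ p = a at *
    generalize MvPolynomial.aeval ρ q = b at *
    generalize MvPolynomial.aeval ρ p' = c at *
    generalize MvPolynomial.aeval ρ q' = d at *
    have hb : b * b⁻¹ = 1 := mul_inv_cancel₀ h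
    have hd : d * d⁻¹ = 1 := mul_inv_cancel₀ h'
    have hbd : (b * d)⁻¹ = b⁻¹ * d⁻¹ := mul_inv b d
    rw [hbd]
    linear_combination a * b⁻¹ * hd + c * d⁻¹ * hb

end FractionTree

/-- Every meadow term equals a case distinction between fractions. -/
theorem MeadowTerm.exists_fractionTree (s : MeadowTerm) :
    ∃ t : FractionTree, ∀ (M : Type u) [CancellationMeadow M] (ρ : ℕ → M),
      s.eval ρ = t.eval ρ := by
  have inv_one' : ∀ (M : Type u) [CancellationMeadow M], (1 : M)⁻¹ = 1 := fun M _ =>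
    letI := CancellationMeadow.toField M
    inv_one
  have mul_inv' : ∀ (M : Type u) [CancellationMeadow M] (x y : M), (x * y)⁻¹ = x⁻¹ * y⁻¹ :=
    fun M _ x y =>
    letI := CancellationMeadow.toField M
    mul_inv x y
  induction s with
  | var i =>
    exact ⟨.leaf (MvPolynomial.X i) 1, fun M _ ρ => by
      simp [MeadowTerm.eval, FractionTree.eval, inv_one']⟩
  | zero => exact ⟨.leaf 0 1, fun M _ ρ => by simp [MeadowTerm.eval, FractionTree.eval]⟩
  | one => exact ⟨.leaf 1 1, fun M _ ρ => by simp [MeadowTerm.eval, FractionTree.eval, inv_one']⟩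
  | neg s ih =>
    obtain ⟨t, ht⟩ := ih
    refine ⟨t.bind fun p q => .leaf (-p) q, fun M _ ρ => ?_⟩
    rw [FractionTree.eval_bind (g := fun x => -x), MeadowTerm.eval, ht]
    intro p q
    simp [FractionTree.eval]
  | inv s ih =>
    obtain ⟨t, ht⟩ := ih
    -- Swapping is correct also where `p` or `q` vanishes, since both values are then `0`.
    refine ⟨t.bind fun p q => .leaf q p, fun M _ ρ => ?_⟩
    rw [FractionTree.eval_bind (g := fun x => x⁻¹), MeadowTerm.eval, ht]
    intro p q
    simp only [FractionTree.eval, mul_inv', Meadow.inv_inv_eq]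
    rw [mul_comm]
  | add s s' ih ih' =>
    obtain ⟨t, ht⟩ := ih
    obtain ⟨t', ht'⟩ := ih'
    -- The nested substitution pairs every leaf of `t` with every leaf of `t'`.
    refine ⟨t.bind fun p q => t'.bind fun p' q' => .addLeaf p q p' q', fun M _ ρ => ?_⟩
    rw [FractionTree.eval_bind (g := fun x => x + t'.eval ρ), MeadowTerm.eval, ht, ht']
    intro p q
    rw [FractionTree.eval_bind (g := fun x => (FractionTree.leaf p q).eval ρ + x)]
    exact FractionTree.eval_addLeaf ρ p q
  | mul s s' ih ih' =>
    obtain ⟨t, ht⟩ := ih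
    obtain ⟨t', ht'⟩ := ih'
    refine ⟨t.bind fun p q => t'.bind fun p' q' => .leaf (p * p') (q * q'), fun M _ ρ => ?_⟩
    rw [FractionTree.eval_bind (g := fun x => x * t'.eval ρ), MeadowTerm.eval, ht, ht']
    intro p q
    rw [FractionTree.eval_bind (g := fun x => (FractionTree.leaf p q).eval ρ * x)]
    intro p' q'
    simp only [FractionTree.eval, map_mul, mul_inv']
    ring

/-- A signed monomial; `(true, l)` stands for the product of the variables in `l` and
`(false, l)` for its opposite. -/
abbrev SignedMonomial : Type := Bool × List ℕ

/-- The value of a signed monomial. -/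
def SignedMonomial.eval {M : Type u} [Meadow M] (ρ : ℕ → M) (w : SignedMonomial) : M :=
  if w.1 then (w.2.map ρ).prod else -(w.2.map ρ).prod

/-- The value of a sum of signed monomials. -/
def monomialSum {M : Type u} [Meadow M] (ρ : ℕ → M) (p : List SignedMonomial) : M :=
  (p.map (SignedMonomial.eval ρ)).sum

/-- An integer coefficient is unrolled into repeated monomials of one sign, and a power into
repeated variables, so that the code needs no constants beyond `0` and `1`. -/
theorem exists_monomialSum_eq (p : MvPolynomial ℕ ℤ) :
    ∃ l : List SignedMonomial, ∀ (M : Type u) [Meadow M] (ρ : ℕ → M),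
      MvPolynomial.aeval ρ p = monomialSum ρ l := by
  induction p using MvPolynomial.induction_on with
  | C a =>
    refine ⟨List.replicate a.natAbs (decide (0 ≤ a), []), fun M _ ρ => ?_⟩
    rw [MvPolynomial.aeval_C, eq_intCast]
    have hs : ∀ b : Bool, monomialSum ρ (List.replicate a.natAbs (b, [])) =
        (a.natAbs : M) * if b then 1 else -1 := fun b => by
      simp [monomialSum, SignedMonomial.eval]
    rw [hs, ← Int.cast_natCast, Int.natCast_natAbs]
    rcases le_or_gt 0 a with h | h
    · simp [h, abs_of_nonneg h]
    · simp [h.not_ge, abs_of_neg h]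
  | add p q ihp ihq =>
    obtain ⟨l, hl⟩ := ihp
    obtain ⟨l', hl'⟩ := ihq
    refine ⟨l ++ l', fun M _ ρ => ?_⟩
    rw [map_add, hl, hl']
    simp [monomialSum]
  | mul_X p i ih =>
    obtain ⟨l, hl⟩ := ih
    refine ⟨l.map fun w => (w.1, i :: w.2), fun M _ ρ => ?_⟩
    rw [map_mul, hl, MvPolynomial.aeval_X]
    simp only [monomialSum, List.map_map, ← List.sum_map_mul_right]
    congr 1
    refine List.map_congr_left fun w _ => ?_
    rcases w with ⟨_ | _, w⟩ <;> simp [SignedMonomial.eval, mul_comm]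

/-- The value of a sum of fractions. -/
def fractionSum {M : Type u} [Meadow M] (ρ : ℕ → M)
    (L : List (List SignedMonomial × List SignedMonomial)) : M :=
  (L.map fun w => monomialSum ρ w.1 * (monomialSum ρ w.2)⁻¹).sum

/-- With `e = c * c⁻¹`, a node has the value `s - e * s + e * t`. Multiplying by `e` keeps a sum of
fractions: `p / q` becomes `(p * c) / (q * c)`, valid also at zeros because inversion is
multiplicative everywhere. -/
theorem FractionTree.exists_sum_eq (t : FractionTree) :
    ∃ L : List (MvPolynomial ℕ ℤ × MvPolynomial ℕ ℤ),
      ∀ (M : Type u) [CancellationMeadow M] (ρ : ℕ → M),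
        t.eval ρ =
          (L.map fun w => MvPolynomial.aeval ρ w.1 * (MvPolynomial.aeval ρ w.2)⁻¹).sum := by
  induction t with
  | leaf p q => exact ⟨[(p, q)], fun M _ ρ => by simp [FractionTree.eval]⟩
  | node c s t ihs iht =>
    obtain ⟨L, hL⟩ := ihs
    obtain ⟨L', hL'⟩ := iht
    refine ⟨L ++ (L.map fun w => (-(w.1 * c), w.2 * c)) ++ L'.map fun w => (w.1 * c, w.2 * c),
      fun M _ ρ => ?_⟩
    let := CancellationMeadow.toField M
    have key : ∀ x y z : M, (x * z) * (y * z)⁻¹ = (x * y⁻¹) * (z * z⁻¹) := fun x y z => by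
      have h : (y * z)⁻¹ = y⁻¹ * z⁻¹ := mul_inv y z
      rw [h]; ring
    have hneg : ∀ f : MvPolynomial ℕ ℤ × MvPolynomial ℕ ℤ → M,
        (L.map fun w => -f w).sum = -(L.map f).sum := fun f => by
      simpa using List.sum_map_mul_right L f (-1)
    simp only [FractionTree.eval, hL, hL', List.map_append, List.sum_append, List.map_map,
      Function.comp_def, map_mul, map_neg, neg_mul, key, hneg,
      List.sum_map_mul_right]
    split_ifs with h
    · rw [h]; ring
    · have h' : MvPolynomial.aeval ρ c * (MvPolynomial.aeval ρ c)⁻¹ = 1 := mul_inv_cancel₀ h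
      rw [h']; ring

/-- Every meadow term equals a sum of fractions. -/
theorem MeadowTerm.exists_fractionSum_eq (s : MeadowTerm) :
    ∃ L : List (List SignedMonomial × List SignedMonomial),
      ∀ (M : Type u) [CancellationMeadow M] (ρ : ℕ → M), s.eval ρ = fractionSum ρ L := by
  obtain ⟨t, ht⟩ := s.exists_fractionTree
  obtain ⟨L, hL⟩ := t.exists_sum_eq
  choose f hf using exists_monomialSum_eq.{u}
  refine ⟨L.map fun w => (f w.1, f w.2), fun M _ ρ => ?_⟩
  rw [ht, hL]
  simp only [fractionSum, List.map_map, Function.comp_def, hf]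

/-! ### Straight-line code -/

/-- The finite instruction sequence that performs the given basic instructions and halts. -/
def straightLine : List Ins → InstrSeq Ins
  | [] => .prim .halt
  | i :: l => .concat (.prim (.basic i)) (straightLine l)

theorem straightLine_canon (l : List Ins) :
    (straightLine l).canon = (l.map Primitive.basic ++ [.halt], []) := by
  induction l with
  | nil => rfl
  | cons i l ih => simp [straightLine, InstrSeq.canon, ih]

theorem straightLine_instrAt (l : List Ins) (p : ℕ) :
    (straightLine l).instrAt p = (l.map Primitive.basic ++ [.halt])[p]? := by
  rw [InstrSeq.instrAt, straightLine_canon]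
  split_ifs with h
  · rfl
  · simpa using h

open Classical in
theorem InstrSeq.landing_of_not_isJumpAt {A : Type} {I : InstrSeq A} {p : ℕ}
    (h : ¬ I.IsJumpAt p) : I.landing p = some p := by
  have h' : ∃ n, ¬ I.IsJumpAt (I.hop^[n] p) := ⟨0, h⟩
  rw [InstrSeq.landing, dif_pos h', Option.some_inj, (Nat.find_eq_zero _).2 h]
  rfl

/-- The prefix `pre` is the code already passed: during the induction the sequence stays fixed and
only the position moves. The extra unit of depth is for `!`. -/
theorem straightLine_exec {M : Type u} [Meadow M] (pre l : List Ins) (α : Var → M)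
    (hl : ∀ i ∈ l, ∀ j, i ≠ .testZero j) :
    Thread.exec (l.length + 1)
      (PFunctor.M.corec (straightLine (pre ++ l)).step pre.length) α =
        some (l.foldl (fun γ i => i.effect γ) α) := by
  induction l generalizing pre α with
  | nil =>
    have h : (straightLine (pre ++ [])).instrAt pre.length = some .halt := by
      simp [straightLine_instrAt]
    have h' : (straightLine (pre ++ [])).step pre.length = ⟨.terminate, Empty.elim⟩ := by
      rw [InstrSeq.step, InstrSeq.landing_of_not_isJumpAt (by rw [InstrSeq.IsJumpAt, h]; nofun)]
      simp only [h]
      rfl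
    have hd : (PFunctor.M.corec (straightLine (pre ++ [])).step pre.length).dest =
        ⟨.terminate, fun b => b.elim⟩ := by
      rw [PFunctor.M.dest_corec, h']
      exact congrArg (Sigma.mk _) (funext fun b => b.elim)
    exact Thread.exec_succ_terminate hd 0
  | cons i l ih =>
    have h : (straightLine (pre ++ i :: l)).instrAt pre.length = some (.basic i) := by
      simp [straightLine_instrAt]
    have h' : (straightLine (pre ++ i :: l)).step pre.length =
        ⟨.post i, fun _ => pre.length + 1⟩ := by
      rw [InstrSeq.step, InstrSeq.landing_of_not_isJumpAt (by rw [InstrSeq.IsJumpAt, h]; nofun)]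
      simp only [h]
      rfl
    have hd : (PFunctor.M.corec (straightLine (pre ++ i :: l)).step pre.length).dest =
        ⟨.post i, fun _ => PFunctor.M.corec (straightLine (pre ++ i :: l)).step
          (pre.length + 1)⟩ := by
      rw [PFunctor.M.dest_corec, h']
      rfl
    rw [List.length_cons, Thread.exec_succ_post hd, List.foldl_cons]
    have := ih (pre ++ [i]) (i.effect α) fun j hj => hl j (List.mem_cons_of_mem _ hj)
    simpa using this

theorem straightLine_isStraightLine {l : List Ins} (hl : ∀ i ∈ l, ∀ j, i ≠ .testZero j) :
    (straightLine l).IsStraightLine := by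
  induction l with
  | nil => trivial
  | cons i l ih =>
    refine ⟨?_, ih fun j hj => hl j (List.mem_cons_of_mem _ hj)⟩
    cases i
    case testZero j => exact hl _ List.mem_cons_self j rfl
    all_goals trivial

theorem straightLine_auxVars_subset {l : List Ins} {s : Finset ℕ}
    (hl : ∀ i ∈ l, i.auxVars ⊆ s) : (straightLine l).auxVars ⊆ s := by
  induction l with
  | nil => exact Finset.empty_subset s
  | cons i l ih =>
    exact Finset.union_subset (hl i List.mem_cons_self)
      (ih fun j hj => hl j (List.mem_cons_of_mem _ hj))

theorem auxVars_subset_straightLine {l : List Ins} {i : Ins} (hi : i ∈ l) :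
    i.auxVars ⊆ (straightLine l).auxVars := by
  induction l with
  | nil => cases hi
  | cons j l ih =>
    rcases List.mem_cons.1 hi with rfl | hi
    · exact Finset.subset_union_left
    · exact (ih hi).trans Finset.subset_union_right

/-! ### Code for sums of fractions

The variables `a_0, …, a_3` hold the sum of the fractions, the (inverse of the) current denominator,
the current monomial and the current input. -/

/-- Load a signed monomial into `a_2`. -/
def loadMonomial (w : SignedMonomial) : List Ins :=
  .setOne 2 :: (w.2.flatMap fun j => [.cpIn 3 j, .setMul 2 3]) ++ if w.1 then [] else [.setNeg 2]

/-- Load a denominator into `a_1` and invert it. -/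
def loadDenominator (q : List SignedMonomial) : List Ins :=
  .setZero 1 :: (q.flatMap fun w => loadMonomial w ++ [.setAdd 1 2]) ++ [.setInv 1]

/-- Add the product of a sum of monomials and `a_1` to `a_0`. -/
def addNumerator (p : List SignedMonomial) : List Ins :=
  p.flatMap fun w => loadMonomial w ++ [.setMul 2 1, .setAdd 0 2]

/-- Calculate a sum of fractions. -/
def fractionSumCode (L : List (List SignedMonomial × List SignedMonomial)) : List Ins :=
  [.setZero 0, .setZero 1, .setZero 2, .setZero 3] ++
    (L.flatMap fun w => loadDenominator w.2 ++ addNumerator w.1) ++ [.cpOut 0]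

section Code

variable {M : Type u} [Meadow M] {ρ : ℕ → M}

/-- The assignment `α` has inputs `ρ`, and values `s`, `q`, `r` of `a_0`, `a_1`, `a_2`. -/
def Holds (ρ : ℕ → M) (s q r : M) (α : Var → M) : Prop :=
  (∀ i, α (.x i) = ρ i) ∧ α (.a 0) = s ∧ α (.a 1) = q ∧ α (.a 2) = r

theorem Holds.mul_add {s q r : M} {α : Var → M} (h : Holds ρ s q r α) :
    Holds ρ (s + r * q) q (r * q) ((Ins.setAdd 0 2).effect ((Ins.setMul 2 1).effect α)) := by
  obtain ⟨hx, h0, h1, h2⟩ := h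
  simp [Holds, Ins.effect, hx, h0, h1, h2]

theorem Holds.add_denominator {s q r : M} {α : Var → M} (h : Holds ρ s q r α) :
    Holds ρ s (q + r) r ((Ins.setAdd 1 2).effect α) := by
  obtain ⟨hx, h0, h1, h2⟩ := h
  simp [Holds, Ins.effect, hx, h0, h1, h2]

theorem Holds.inv_denominator {s q r : M} {α : Var → M} (h : Holds ρ s q r α) :
    Holds ρ s q⁻¹ r ((Ins.setInv 1).effect α) := by
  obtain ⟨hx, h0, h1, h2⟩ := h
  simp [Holds, Ins.effect, hx, h0, h1, h2]

theorem Holds.neg_monomial {s q r : M} {α : Var → M} (h : Holds ρ s q r α) :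
    Holds ρ s q (-r) ((Ins.setNeg 2).effect α) := by
  obtain ⟨hx, h0, h1, h2⟩ := h
  simp [Holds, Ins.effect, hx, h0, h1, h2]

/-- The value of `a_3` need not be tracked, as it is overwritten before each use. -/
theorem holds_mulVars (l : List ℕ) {s q r : M} {α : Var → M} (h : Holds ρ s q r α) :
    Holds ρ s q (r * (l.map ρ).prod)
      ((l.flatMap fun j => [Ins.cpIn 3 j, .setMul 2 3]).foldl (fun γ i => i.effect γ) α) := by
  induction l generalizing r α with
  | nil => simpa using h
  | cons j l ih =>
    obtain ⟨hx, h0, h1, h2⟩ := h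
    have h' : Holds ρ s q (r * ρ j) ((Ins.setMul 2 3).effect ((Ins.cpIn 3 j).effect α)) := by
      simp [Holds, Ins.effect, hx, h0, h1, h2]
    simpa [mul_assoc] using ih h'

theorem holds_loadMonomial (w : SignedMonomial) {s q r : M} {α : Var → M} (h : Holds ρ s q r α) :
    Holds ρ s q (w.eval ρ) ((loadMonomial w).foldl (fun γ i => i.effect γ) α) := by
  have h' : Holds ρ s q 1 ((Ins.setOne 2).effect α) := by
    obtain ⟨hx, h0, h1, h2⟩ := h
    simp [Holds, Ins.effect, hx, h0, h1]
  have := holds_mulVars w.2 h'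
  rcases w with ⟨_ | _, w⟩
  · simpa [loadMonomial, SignedMonomial.eval] using this.neg_monomial
  · simpa [loadMonomial, SignedMonomial.eval] using this

/-- The inverted denominator is distributed over the monomials, so the numerator needs no register
of its own. What remains in `a_2` is irrelevant. -/
theorem holds_addNumerator (p : List SignedMonomial) {s q r : M} {α : Var → M}
    (h : Holds ρ s q r α) :
    ∃ r', Holds ρ (s + monomialSum ρ p * q) q r'
      ((addNumerator p).foldl (fun γ i => i.effect γ) α) := by
  induction p generalizing s r α with
  | nil => exact ⟨r, by simpa [addNumerator, monomialSum] using h⟩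
  | cons w p ih =>
    obtain ⟨r', hr'⟩ := ih (holds_loadMonomial w h).mul_add
    exact ⟨r', by simpa [addNumerator, monomialSum, add_mul, add_assoc] using hr'⟩

theorem holds_addDenominator (p : List SignedMonomial) {s q r : M} {α : Var → M}
    (h : Holds ρ s q r α) :
    ∃ r', Holds ρ s (q + monomialSum ρ p) r'
      ((p.flatMap fun w => loadMonomial w ++ [.setAdd 1 2]).foldl (fun γ i => i.effect γ) α) := by
  induction p generalizing q r α with
  | nil => exact ⟨r, by simpa [monomialSum] using h⟩
  | cons w p ih =>
    obtain ⟨r', hr'⟩ := ih (holds_loadMonomial w h).add_denominator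
    exact ⟨r', by simpa [monomialSum, add_assoc] using hr'⟩

theorem holds_loadDenominator (p : List SignedMonomial) {s q r : M} {α : Var → M}
    (h : Holds ρ s q r α) :
    ∃ r', Holds ρ s (monomialSum ρ p)⁻¹ r'
      ((loadDenominator p).foldl (fun γ i => i.effect γ) α) := by
  have h' : Holds ρ s 0 r ((Ins.setZero 1).effect α) := by
    obtain ⟨hx, h0, h1, h2⟩ := h
    simp [Holds, Ins.effect, hx, h0, h2]
  obtain ⟨r', hr'⟩ := holds_addDenominator p h'
  refine ⟨r', ?_⟩
  rw [loadDenominator, List.cons_append, List.foldl_cons, List.foldl_append]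
  simpa using hr'.inv_denominator

theorem holds_fractionSum (L : List (List SignedMonomial × List SignedMonomial)) {s q r : M}
    {α : Var → M} (h : Holds ρ s q r α) :
    ∃ q' r', Holds ρ (s + fractionSum ρ L) q' r'
      ((L.flatMap fun w => loadDenominator w.2 ++ addNumerator w.1).foldl
        (fun γ i => i.effect γ) α) := by
  induction L generalizing s q r α with
  | nil => exact ⟨q, r, by simpa [fractionSum] using h⟩
  | cons w L ih =>
    obtain ⟨r₁, h₁⟩ := holds_loadDenominator w.2 h
    obtain ⟨r₂, h₂⟩ := holds_addNumerator w.1 h₁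
    obtain ⟨q', r', hr'⟩ := ih h₂
    exact ⟨q', r', by simpa [fractionSum, add_assoc] using hr'⟩

theorem fractionSumCode_output (L : List (List SignedMonomial × List SignedMonomial))
    {α : Var → M} (hα : ∀ i, α (.x i) = ρ i) :
    (fractionSumCode L).foldl (fun γ i => i.effect γ) α .y = fractionSum ρ L := by
  have h : Holds ρ 0 0 0 ([Ins.setZero 0, .setZero 1, .setZero 2, .setZero 3].foldl
      (fun γ i => i.effect γ) α) := by
    simp [Holds, Ins.effect, hα]
  obtain ⟨q, r, -, h0, -⟩ := holds_fractionSum L h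
  rw [fractionSumCode, List.foldl_append, List.foldl_append]
  simpa [Ins.effect] using h0

end Code

theorem mem_fractionSumCode {L : List (List SignedMonomial × List SignedMonomial)} {i : Ins}
    (hi : i ∈ fractionSumCode L) :
    (∀ j, i ≠ .testZero j) ∧ i.auxVars ⊆ Finset.range 4 := by
  have hm : ∀ w : SignedMonomial, i ∈ loadMonomial w →
      (∀ j, i ≠ .testZero j) ∧ i.auxVars ⊆ Finset.range 4 := by
    rintro ⟨b, w⟩ h
    simp only [loadMonomial, List.mem_append, List.mem_cons, List.mem_flatMap] at h
    rcases h with (rfl | ⟨j, -, rfl | rfl | h⟩) | h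
    · exact ⟨nofun, by decide⟩
    · exact ⟨nofun, by simp [Ins.auxVars]⟩
    · exact ⟨nofun, by decide⟩
    · cases h
    · cases b
      · obtain rfl := List.mem_singleton.1 h
        exact ⟨nofun, by decide⟩
      · cases h
  simp only [fractionSumCode, loadDenominator, addNumerator, List.mem_append, List.mem_cons,
    List.mem_flatMap, List.not_mem_nil, or_false] at hi
  rcases hi with ((rfl | rfl | rfl | rfl) | ⟨w, -, ((rfl | ⟨v, -, h | rfl⟩) | rfl) |
    ⟨v, -, h | rfl | rfl⟩⟩) | rfl
  all_goals first | exact hm v h | exact ⟨nofun, by decide⟩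

theorem fractionSumCode_usesAux (L : List (List SignedMonomial × List SignedMonomial)) :
    (straightLine (fractionSumCode L)).UsesAux 4 := by
  refine (straightLine_auxVars_subset fun i hi => (mem_fractionSumCode hi).2).antisymm ?_
  -- The initial resets make all four variables occur even if `L` is empty, as `UsesAux` demands
  -- equality.
  have h : ∀ j < 4, Ins.setZero j ∈ fractionSumCode L := fun j hj => by
    interval_cases j <;> simp [fractionSumCode]
  exact fun j hj => auxVars_subset_straightLine (h j (Finset.mem_range.1 hj))
    (Finset.mem_singleton_self j)

end MeadowProgram

/-! ### Elimination of tests and jumps with four auxiliary variables -/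

theorem mainTheorem1 (I : MeadowProgram.InstrSeq MeadowProgram.Ins) (k : ℕ)
    (hI : ∀ (M : Type u) [MeadowProgram.CancellationMeadow M] (m : Fin (k + 1) → M),
      (I.mapping M k m).Dom) :
    ∃ J : MeadowProgram.InstrSeq MeadowProgram.Ins,
      J.IsStraightLine ∧ (∃ n, n ≤ 5 ∧ J.UsesAux n) ∧
        ∀ (M : Type u) [MeadowProgram.CancellationMeadow M], I.mapping M k = J.mapping M k := by
  open MeadowProgram in
  obtain ⟨N, hN⟩ := Thread.exists_exec_bound I.thread k fun M _ m =>
    Thread.exists_exec_of_mapping_dom (hI M m)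
  -- The symbolic form of `initial`: inputs beyond `x_k` are `0`, as they are in `ρ` below.
  obtain ⟨t, ht⟩ := Thread.exists_meadowTerm_exec.{u} N I.thread fun v =>
    match v with
    | .x i => if i < k + 1 then .var i else .zero
    | .a _ => .zero
    | .y => .zero
  obtain ⟨L, hL⟩ := t.exists_fractionSum_eq
  refine ⟨straightLine (fractionSumCode L),
    straightLine_isStraightLine fun i hi => (mem_fractionSumCode hi).1,
    ⟨4, by decide, fractionSumCode_usesAux L⟩, fun M _ => funext fun m => ?_⟩
  set ρ : ℕ → M := fun i => initial m (.x i) with hρ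
  have hI' : fractionSum ρ L ∈ I.mapping M k m := by
    obtain ⟨β, hβ⟩ := hN M m
    refine Thread.mem_mapping_iff.2 ⟨N, β, hβ, ?_⟩
    rw [← hL]
    refine ht M ρ β (Eq.trans (congrArg _ (funext fun v => ?_)) hβ)
    cases v with
    | x i =>
      by_cases hi : i < k + 1
      · simp [hi, MeadowTerm.eval, hρ]
      · simp [hi, MeadowTerm.eval, initial]
    | a i => rfl
    | y => rfl
  have hJ : fractionSum ρ L ∈ (straightLine (fractionSumCode L)).mapping M k m :=
    Thread.mem_mapping_iff.2 ⟨_, _, straightLine_exec [] (fractionSumCode L) (initial m)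
      fun i hi => (mem_fractionSumCode hi).1, fractionSumCode_output L fun _ => rfl⟩
  -- A partial value has at most one member, so sharing one forces equality.
  exact (Part.eq_some_iff.2 hI').trans (Part.eq_some_iff.2 hJ).symm
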